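/- A manifold with corners (of dimension $n$) is a second countable Hausdorff space with a $C^\infty$ atlas modelled on $[0,\infty)^n$; maps between subsets of Euclidean spaces are smooth if they extend locally to smooth maps. A smooth map is an embedding if its differential is injective at every point and it is a topological embedding; let $\mathbf{Emb}$ be the category of manifolds with corners and smooth embeddings. Let $S$ be a finite poset with a maximum. A pre-arrangement of shape $S$ is a functor $\mathcal X\colon S\to\mathbf{Emb}$; its ambient manifold is $|\mathcal X|=\mathcal X(\max S)$, and it is closed if $\mathcal X(s)\to\mathcal X(t)$ is a closed embedding for all $s\le t$ in $S$. For two pre-arrangements $\mathcal X,\mathcal Y$ of the same shape $S$, let $C^\infty(\mathcal X,\mathcal Y)$ be the set of smooth maps $F\colon|\mathcal X|\to|\mathcal Y|$ such that $F$ maps (the image of) $\mathcal X(s)$ into (the image of) $\mathcal Y(s)$ for every $s\in S$. It carries the subspace topology of the Whitney $C^\infty$-topology on $C^\infty(|\mathcal X|,|\mathcal Y|)$, which is generated by the sets $\{F\mid j^rF(|\mathcal X|)\subset U\}$ for $r\in\mathbb N$ and $U$ open in the jet bundle $J^r(|\mathcal X|,|\mathcal Y|)$. Here, for manifolds with corners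 $X,Y$, the fibre of $J^r(X,Y)\to X\times Y$ over $(p,q)$ is the set of $\mathbb R$-algebra homomorphisms $C^\infty_q(Y)/\mathfrak m_q^{r+1}\to C^\infty_p(X)/\mathfrak m_p^{r+1}$ between quotients of the algebras of germs of smooth functions by powers of their maximal ideals, $J^r(X,Y)$ is topologized as a fibre bundle by means of Taylor expansions in charts, and $j^rF(p)$ is the homomorphism induced by pulling back germs along $F$. Theorem. If $\mathcal X$ and $\mathcal Y$ are closed pre-arrangements of manifolds with corners of the same shape $S$, then $C^\infty(\mathcal X,\mathcal Y)$ is a Baire space, i.e. every countable intersection of open dense subsets of $C^\infty(\mathcal X,\mathcal Y)$ is dense. -/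

import Mathlib

open Set Filter Topology CategoryTheory
open scoped Manifold ContDiff

universe u v w

noncomputable section

/-- A (smooth) manifold with corners: a second countable Hausdorff space with a `C^∞` structure
modelled on the quadrant `[0,∞)^dim`. -/
structure MfdCorners : Type (u + 1) where
  carrier : Type u
  dim : ℕ
  [topologicalSpace : TopologicalSpace carrier]
  [chartedSpace : ChartedSpace (EuclideanQuadrant dim) carrier]
  [isManifold : IsManifold (modelWithCornersEuclideanQuadrant dim) ∞ carrier]
  [t2Space : T2Space carrier]
  [secondCountable : SecondCountableTopology carrier]

namespace MfdCorners

instance : CoeSort MfdCorners.{u} (Type u) := ⟨MfdCorners.carrier⟩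

attribute [instance] topologicalSpace chartedSpace isManifold t2Space secondCountable

/-- The Euclidean space containing the model quadrant of `X`. -/
abbrev E (X : MfdCorners.{u}) : Type := EuclideanSpace ℝ (Fin X.dim)

/-- The quadrant on which `X` is modelled. -/
abbrev H (X : MfdCorners.{u}) : Type := EuclideanQuadrant X.dim

/-- The model with corners of `X`, that is, the inclusion of the quadrant in the Euclidean space. -/
abbrev I (X : MfdCorners.{u}) : ModelWithCorners ℝ X.E X.H :=
  modelWithCornersEuclideanQuadrant X.dim

end MfdCorners

/-- The set `C^∞(X, Y)` of smooth maps. -/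
abbrev SmoothMap (X : MfdCorners.{u}) (Y : MfdCorners.{v}) : Type (max u v) :=
  C^∞⟮X.I, X; Y.I, Y⟯

/-! ### The category of manifolds with corners and smooth embeddings -/

/-- Smooth embeddings: smooth maps which are immersions (in the sense that the differential is
injective at every point; no normal form in charts is asked for at the corners) and topological
embeddings. -/
@[ext]
structure SmoothEmb (X Y : MfdCorners.{u}) where
  toFun : X → Y
  smooth : ContMDiff X.I Y.I ∞ toFun
  immersion : ∀ p : X, Function.Injective (mfderiv X.I Y.I toFun p)
  embedding : IsEmbedding toFun

/-- The category `Emb` of manifolds with corners and smooth embeddings. -/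
instance : Category MfdCorners.{u} where
  Hom X Y := SmoothEmb X Y
  id X :=
    { toFun := id
      smooth := contMDiff_id
      immersion := fun p => by rw [mfderiv_id]; exact Function.injective_id
      embedding := IsEmbedding.id }
  comp f g :=
    { toFun := g.toFun ∘ f.toFun
      smooth := g.smooth.comp f.smooth
      immersion := fun p => by
        rw [mfderiv_comp p (g.smooth.mdifferentiableAt (by simp))
          (f.smooth.mdifferentiableAt (by simp))]
        exact (g.immersion (f.toFun p)).comp (f.immersion p)
      embedding := g.embedding.comp f.embedding }

/-- A pre-arrangement of shape `S` (`S` will be a finite poset with a maximum): a functor from `S`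
to the category of manifolds with corners and smooth embeddings. -/
abbrev PreArrangement (S : Type w) [PartialOrder S] : Type _ := S ⥤ MfdCorners.{u}

namespace PreArrangement

variable {S : Type w} [PartialOrder S]

/-- A pre-arrangement is closed if all its embeddings are closed embeddings. -/
def IsClosed (X : PreArrangement.{u} S) : Prop :=
  ∀ (s t : S) (h : s ≤ t), IsClosedEmbedding (SmoothEmb.toFun (X.map (homOfLE h)))

/-- The ambient manifold `|X|` of a pre-arrangement `X`. -/
def ambient [OrderTop S] (X : PreArrangement.{u} S) : MfdCorners.{u} := X.obj ⊤

/-- The embedding of `X(s)` in the ambient manifold `|X|`. -/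
def incl [OrderTop S] (X : PreArrangement.{u} S) (s : S) : X.obj s → X.ambient :=
  SmoothEmb.toFun (X.map (homOfLE (le_top : s ≤ ⊤)))

end PreArrangement

/-! ### Jets -/

/-- The `ℝ`-algebra structure on germs of real functions. -/
instance germAlgebra {α : Type u} (l : Filter α) : Algebra ℝ (Germ l ℝ) :=
  Algebra.ofModule
    (fun r f g => by
      induction f, g using Germ.inductionOn₂ with
      | h f g => exact congrArg _ (smul_mul_assoc r f g))
    (fun r f g => by
      induction f, g using Germ.inductionOn₂ with
      | h f g => exact congrArg _ (mul_smul_comm r f g))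

section Jets

variable (X : MfdCorners.{u}) (Y : MfdCorners.{v})

/-- `f` is smooth in a neighbourhood of `p`. -/
def SmoothNear {X : MfdCorners.{u}} (p : X) (f : X → ℝ) : Prop :=
  ∀ᶠ x in 𝓝 p, ContMDiffAt X.I 𝓘(ℝ, ℝ) ∞ f x

/-- The algebra `C^∞_p(X)` of germs at `p` of smooth real functions defined near `p`. -/
def smoothGerms {X : MfdCorners.{u}} (p : X) : Subalgebra ℝ (Germ (𝓝 p) ℝ) where
  carrier := {g | ∃ f : X → ℝ, SmoothNear p f ∧ (f : Germ (𝓝 p) ℝ) = g}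
  mul_mem' := by
    rintro _ _ ⟨f, hf, rfl⟩ ⟨g, hg, rfl⟩
    exact ⟨f * g, by filter_upwards [hf, hg] with x h1 h2 using h1.mul h2, rfl⟩
  add_mem' := by
    rintro _ _ ⟨f, hf, rfl⟩ ⟨g, hg, rfl⟩
    exact ⟨f + g, by filter_upwards [hf, hg] with x h1 h2 using h1.add h2, rfl⟩
  algebraMap_mem' := fun r =>
    ⟨fun _ => r, Eventually.of_forall fun _ => contMDiffAt_const, by
      rw [Algebra.algebraMap_eq_smul_one]
      exact congrArg _ (funext fun x => (mul_one r).symm)⟩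

/-- The germ at `p` of a function that is smooth near `p`. -/
def smoothGerm {X : MfdCorners.{u}} (p : X) (f : X → ℝ) (hf : SmoothNear p f) : smoothGerms p :=
  ⟨(f : Germ (𝓝 p) ℝ), f, hf, rfl⟩

/-- The maximal ideal `𝔪_p(X)` of germs vanishing at `p`. -/
def maxIdeal {X : MfdCorners.{u}} (p : X) : Ideal (smoothGerms p) :=
  RingHom.ker ((Germ.valueRingHom (x := p) (E := ℝ)).comp
    ((smoothGerms p).val : smoothGerms p →+* Germ (𝓝 p) ℝ))

/-- The algebra `J^r_p(X) = C^∞_p(X) / 𝔪_p(X)^(r+1)` of `r`-jets at `p`. -/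
abbrev JetAlg {X : MfdCorners.{u}} (r : ℕ) (p : X) : Type u :=
  smoothGerms p ⧸ (maxIdeal p ^ (r + 1))

/-- The total space of the jet bundle `J^r(X, Y)` over `X × Y`, whose fibre over `(p, q)` is the set
of all `ℝ`-algebra homomorphisms `J^r_q(Y) → J^r_p(X)`. -/
structure JetBundle (r : ℕ) where
  src : X
  tgt : Y
  hom : JetAlg r tgt →ₐ[ℝ] JetAlg r src

variable {X Y}

/-- The pull-back of smooth germs along a smooth map. -/
def germPullback (F : SmoothMap X Y) (p : X) : smoothGerms (F p) →ₐ[ℝ] smoothGerms p where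
  toFun g := ⟨g.1.compTendsto F F.contMDiff.continuous.continuousAt, by
    obtain ⟨_, f, hf, rfl⟩ := g
    refine ⟨f ∘ F, ?_, rfl⟩
    filter_upwards [F.contMDiff.continuous.continuousAt.eventually hf] with x hx
    exact hx.comp x F.contMDiff.contMDiffAt⟩
  map_one' := rfl
  map_zero' := rfl
  map_mul' := by rintro ⟨_, f, hf, rfl⟩ ⟨_, g, hg, rfl⟩; rfl
  map_add' := by rintro ⟨_, f, hf, rfl⟩ ⟨_, g, hg, rfl⟩; rfl
  commutes' r := by
    apply Subtype.ext
    change Germ.compTendsto (algebraMap ℝ (Germ (𝓝 (F p)) ℝ) r) F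
      F.contMDiff.continuous.continuousAt = algebraMap ℝ (Germ (𝓝 p) ℝ) r
    simp only [Algebra.algebraMap_eq_smul_one]
    rfl

lemma maxIdeal_le_comap (F : SmoothMap X Y) (p : X) :
    maxIdeal (F p) ≤ (maxIdeal p).comap (germPullback F p) := by
  rintro ⟨_, f, hf, rfl⟩ h
  exact h

/-- The `r`-jet `j^r F(p) : J^r_{F(p)}(Y) → J^r_p(X)` of a smooth map `F`, as a point of the jet
bundle: the homomorphism induced by the pull-back of germs. -/
def jet (r : ℕ) (F : SmoothMap X Y) (p : X) : JetBundle X Y r where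
  src := p
  tgt := F p
  hom := Ideal.quotientMapₐ _ (germPullback F p)
    ((Ideal.pow_right_mono (maxIdeal_le_comap F p) (r + 1)).trans
      (Ideal.le_comap_pow (germPullback F p) (r + 1)))

/-- The charts of `X`: all charts of its maximal `C^∞` atlas. -/
abbrev Chart (X : MfdCorners.{u}) : Type u :=
  {φ : OpenPartialHomeomorph X X.H // φ ∈ IsManifold.maximalAtlas X.I ∞ X}

lemma tendsto_extend_symm (φ : Chart X) {p : X} (hp : p ∈ φ.1.source) :
    Tendsto (φ.1.extend X.I).symm (𝓝[range X.I] (φ.1.extend X.I p)) (𝓝 p) := by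
  have h2 := φ.1.continuousAt_extend_symm (I := X.I) hp
  rw [ContinuousAt, φ.1.extend_left_inv hp] at h2
  exact h2.mono_left nhdsWithin_le_nhds

/-- The derivative of order `k` at `p` of a germ at `p`, read in the chart `φ`. -/
def germDeriv (φ : Chart X) {p : X} (hp : p ∈ φ.1.source) (k : ℕ) (g : Germ (𝓝 p) ℝ) :
    X.E [×k]→L[ℝ] ℝ :=
  g.liftOn
    (fun f => iteratedFDerivWithin ℝ k (f ∘ (φ.1.extend X.I).symm) (range X.I)
      (φ.1.extend X.I p))
    (fun f f' h => by
      refine Filter.EventuallyEq.iteratedFDerivWithin_eq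
        ((tendsto_extend_symm φ hp).eventually (p := fun y => f y = f' y) h) ?_ k
      simp only [φ.1.extend_left_inv hp]
      exact h.self_of_nhds)

lemma exists_contDiffOn (φ : Chart X) {p : X} (hp : p ∈ φ.1.source) {f : X → ℝ}
    (hf : SmoothNear p f) :
    ∃ o : Set X.E, IsOpen o ∧ φ.1.extend X.I p ∈ o ∧
      ContDiffOn ℝ ∞ (f ∘ (φ.1.extend X.I).symm) (range X.I ∩ o) := by
  have h := (tendsto_extend_symm φ hp).eventually hf
  have ht : (φ.1.extend X.I).target ∈ 𝓝[range X.I] (φ.1.extend X.I p) :=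
    φ.1.extend_target_mem_nhdsWithin hp
  obtain ⟨o, ho, hpo, hsub⟩ := mem_nhdsWithin.1 (Filter.inter_mem h ht)
  refine ⟨o, ho, hpo, ?_⟩
  have hsub' : range X.I ∩ o ⊆ (φ.1.extend X.I).target := fun x hx => (hsub ⟨hx.2, hx.1⟩).2
  rw [← contMDiffOn_iff_contDiffOn]
  intro x hx
  have h1 := hsub ⟨hx.2, hx.1⟩
  have h2 : ContMDiffWithinAt 𝓘(ℝ, X.E) X.I ∞ (φ.1.extend X.I).symm (range X.I ∩ o) x :=
    ((contMDiffOn_extend_symm φ.2).mono (by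
      rwa [OpenPartialHomeomorph.extend_target'] at hsub')) x hx
  exact ContMDiffAt.comp_contMDiffWithinAt x h1.1 h2

lemma germDeriv_add_smul (φ : Chart X) {p : X} (hp : p ∈ φ.1.source) (k : ℕ) (c : ℝ)
    (a b : smoothGerms p) :
    germDeriv φ hp k (a.1 + c • b.1) = germDeriv φ hp k a.1 + c • germDeriv φ hp k b.1 := by
  obtain ⟨_, f, hf, rfl⟩ := a
  obtain ⟨_, g, hg, rfl⟩ := b
  obtain ⟨o, ho, hpo, h1⟩ := exists_contDiffOn φ hp hf
  obtain ⟨o', ho', hpo', h2⟩ := exists_contDiffOn φ hp hg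
  have hx : φ.1.extend X.I p ∈ range X.I := mem_range_self _
  have h1' : ContDiffWithinAt ℝ k (f ∘ (φ.1.extend X.I).symm) (range X.I) (φ.1.extend X.I p) :=
    ((h1 _ ⟨hx, hpo⟩).of_le (by exact_mod_cast le_top)).mono_of_mem_nhdsWithin
      (inter_mem_nhdsWithin _ (ho.mem_nhds hpo))
  have h2' : ContDiffWithinAt ℝ k (g ∘ (φ.1.extend X.I).symm) (range X.I) (φ.1.extend X.I p) :=
    ((h2 _ ⟨hx, hpo'⟩).of_le (by exact_mod_cast le_top)).mono_of_mem_nhdsWithin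
      (inter_mem_nhdsWithin _ (ho'.mem_nhds hpo'))
  change iteratedFDerivWithin ℝ k
    ((f ∘ (φ.1.extend X.I).symm) + c • (g ∘ (φ.1.extend X.I).symm)) _ _ = _
  have h3 : ContDiffWithinAt ℝ k (c • (g ∘ (φ.1.extend X.I).symm)) (range X.I)
      (φ.1.extend X.I p) := h2'.const_smul c
  exact (iteratedFDerivWithin_add_apply h1' h3 X.I.uniqueDiffOn hx).trans
    (congrArg _ (iteratedFDerivWithin_const_smul_apply h2' X.I.uniqueDiffOn hx))

/-- `germDeriv` as a linear map on `C^∞_p(X)`. -/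
def germDerivₗ (φ : Chart X) {p : X} (hp : p ∈ φ.1.source) (k : ℕ) :
    smoothGerms p →ₗ[ℝ] X.E [×k]→L[ℝ] ℝ :=
  .mk (.mk (fun g => germDeriv φ hp k g.1) (fun a b => by
      simpa using germDeriv_add_smul φ hp k 1 a b))
    (fun c a => by
      have h0 : germDeriv φ hp k (0 : Germ (𝓝 p) ℝ) = 0 := by
        simpa using germDeriv_add_smul φ hp k 1 0 0
      simpa [h0] using germDeriv_add_smul φ hp k c 0 a)

lemma germDeriv_mul (φ : Chart X) {p : X} (hp : p ∈ φ.1.source) {a b : smoothGerms p} {n : ℕ}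
    (ha : a ∈ maxIdeal p) (hb : ∀ k < n, germDerivₗ φ hp k b = 0) :
    ∀ k < n + 1, germDerivₗ φ hp k (a * b) = 0 := by
  intro k hk
  obtain ⟨_, f, hf, rfl⟩ := a
  obtain ⟨_, g, hg, rfl⟩ := b
  obtain ⟨o, ho, hpo, h1⟩ := exists_contDiffOn φ hp hf
  obtain ⟨o', ho', hpo', h2⟩ := exists_contDiffOn φ hp hg
  have hx : φ.1.extend X.I p ∈ range X.I := mem_range_self _
  have hoo : IsOpen (o ∩ o') := ho.inter ho'
  have hxo : φ.1.extend X.I p ∈ o ∩ o' := ⟨hpo, hpo'⟩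
  have key := norm_iteratedFDerivWithin_mul_le (n := k)
    (h1.mono (inter_subset_inter_right (range X.I) (inter_subset_left (t := o'))))
    (h2.mono (inter_subset_inter_right (range X.I) (inter_subset_right (s := o))))
    (X.I.uniqueDiffOn.inter hoo) ⟨hx, hxo⟩ (by exact_mod_cast le_top)
  simp only [iteratedFDerivWithin_inter_open hoo hxo] at key
  have hz : ∀ i ∈ Finset.range (k + 1), (k.choose i : ℝ) *
      ‖iteratedFDerivWithin ℝ i (f ∘ (φ.1.extend X.I).symm) (range X.I) (φ.1.extend X.I p)‖ *
      ‖iteratedFDerivWithin ℝ (k - i) (g ∘ (φ.1.extend X.I).symm) (range X.I)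
        (φ.1.extend X.I p)‖ = 0 := by
    intro i hi'
    have hik := Finset.mem_range.1 hi'
    rcases Nat.eq_zero_or_pos i with rfl | hi
    · have hfp : f p = 0 := ha
      rw [norm_iteratedFDerivWithin_zero, Function.comp_apply, φ.1.extend_left_inv hp, hfp]
      simp
    · have : iteratedFDerivWithin ℝ (k - i) (g ∘ (φ.1.extend X.I).symm) (range X.I)
          (φ.1.extend X.I p) = 0 := hb (k - i) (by omega)
      rw [this]
      simp
  rw [Finset.sum_eq_zero hz] at key
  exact norm_le_zero_iff.1 key

lemma germDeriv_eq_zero (φ : Chart X) {p : X} (hp : p ∈ φ.1.source) (n : ℕ) {a : smoothGerms p}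
    (ha : a ∈ maxIdeal p ^ n) : ∀ k < n, germDerivₗ φ hp k a = 0 := by
  induction n generalizing a with
  | zero => intro k hk; omega
  | succ n ih =>
    rw [pow_succ'] at ha
    refine Submodule.mul_induction_on ha (fun x hx y hy => germDeriv_mul φ hp hx (ih hy)) ?_
    intro x y hx hy k hk
    rw [map_add, hx k hk, hy k hk, add_zero]

/-- The Taylor coefficients of order `k ≤ r` of an `r`-jet of functions at `p` in the chart `φ`. -/
def jetDeriv (φ : Chart X) {p : X} (hp : p ∈ φ.1.source) (r : ℕ) (k : Fin (r + 1)) :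
    JetAlg r p →ₗ[ℝ] X.E [×k]→L[ℝ] ℝ :=
  (Submodule.liftQ ((maxIdeal p ^ (r + 1)).restrictScalars ℝ) (germDerivₗ φ hp k)
      (fun _ ha => germDeriv_eq_zero φ hp (r + 1) ha k k.2)) ∘ₗ
    (Submodule.Quotient.restrictScalarsEquiv ℝ (maxIdeal p ^ (r + 1))).symm.toLinearMap

/-- The germ at `q` of the `j`-th coordinate function `ψ_j - ψ_j(q)` of the chart `ψ`. -/
def coordGerm (ψ : Chart Y) {q : Y} (hq : q ∈ ψ.1.source) (j : Fin Y.dim) : smoothGerms q :=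
  smoothGerm q (fun y => ψ.1.extend Y.I y j - ψ.1.extend Y.I q j) (by
    filter_upwards [ψ.1.open_source.mem_nhds hq] with y hy
    have h := ψ.1.contMDiffAt_extend ψ.2 hy
    have h2 : ContDiff ℝ ∞ (fun v : Y.E => v j - ψ.1.extend Y.I q j) := by fun_prop
    exact h2.contMDiff.contMDiffAt.comp y h)

/-- The space in which coordinates on `J^r(X, Y)` take their values: a base point in either quadrant
and, for each coordinate of `Y`, the Taylor coefficients of orders `0, …, r`. -/
abbrev JetCoord (X : MfdCorners.{u}) (Y : MfdCorners.{v}) (r : ℕ) : Type :=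
  X.H × Y.H × (Fin Y.dim → ∀ k : Fin (r + 1), X.E [×k]→L[ℝ] ℝ)

/-- The coordinates of a jet with respect to charts `φ` of `X` and `ψ` of `Y`: its source and target
and the Taylor expansions at its source of the images of the coordinate functions `ψ_j - ψ_j(q)`
under the homomorphism `J^r_q(Y) → J^r_p(X)`. This identifies the part of `J^r(X, Y)` over
`φ.source × ψ.source` with `φ.target × ψ.target` times the space of polynomial maps of degree at
most `r` and vanishing at `0`. -/
def jetCoord (r : ℕ) (φ : Chart X) (ψ : Chart Y) (j : JetBundle X Y r)
    (hp : j.src ∈ φ.1.source) (hq : j.tgt ∈ ψ.1.source) : JetCoord X Y r :=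
  (φ.1 j.src, ψ.1 j.tgt,
    fun i k => jetDeriv φ hp r k (j.hom (Ideal.Quotient.mk _ (coordGerm ψ hq i))))

/-- The topology of the jet bundle `J^r(X, Y)`, determined by its charts: the part over the product
of a chart domain of `X` and one of `Y` is open and carries the topology given by the
coordinates. -/
instance (r : ℕ) : TopologicalSpace (JetBundle X Y r) :=
  TopologicalSpace.generateFrom
    {W | ∃ (φ : Chart X) (ψ : Chart Y) (O : Set (JetCoord X Y r)), IsOpen O ∧
      W = {j | ∃ (hp : j.src ∈ φ.1.source) (hq : j.tgt ∈ ψ.1.source),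
        jetCoord r φ ψ j hp hq ∈ O}}

end Jets

/-! ### The Whitney topology and relative maps -/

/-- The Whitney `C^∞` topology on `C^∞(X, Y)`: it is generated by the sets
`M(U) = {F | j^r F(X) ⊆ U}` for `r : ℕ` and `U` open in `J^r(X, Y)`. -/
instance whitneyTopology (X : MfdCorners.{u}) (Y : MfdCorners.{v}) :
    TopologicalSpace (SmoothMap X Y) :=
  TopologicalSpace.generateFrom
    {M | ∃ (r : ℕ) (U : Set (JetBundle X Y r)), IsOpen U ∧ M = {F | ∀ p : X, jet r F p ∈ U}}

/-- The space `C^∞(X, Y)` of `S`-maps between pre-arrangements `X`, `Y` of shape `S`: smooth maps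
`|X| → |Y|` which map `X(s)` to `Y(s)` for each `s`. As a subtype it carries the topology induced by
the Whitney `C^∞` topology of `C^∞(|X|, |Y|)`. -/
abbrev RelMap {S : Type w} [PartialOrder S] [OrderTop S]
    (X : PreArrangement.{u} S) (Y : PreArrangement.{v} S) : Type (max u v) :=
  {F : SmoothMap X.ambient Y.ambient // ∀ s : S, MapsTo F (range (X.incl s)) (range (Y.incl s))}

end

noncomputable section

/-! ### Uniform limits of smooth functions on convex sets, boundary points included -/

section UniformLimits

/-! The Whitney topology is in general not metrizable when the source is not compact, so the proof
imitates that of Baire's theorem for complete metric spaces, with closed conditions on jets in place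
of closed balls. An admissible family `A` is a locally finite family of conditions of bounded order,
each over a compact subset of a chart domain. The maps satisfying it strictly form an open set
`strictSet A`, while the closed version `weakSet A` survives suitable limits. By
`exists_admissible`, each neighbourhood of `F` contains some `weakSet A` with `F ∈ strictSet A`.

Given open dense sets `f n` and an open set `V`, one builds maps `F n` and increasing families `A n`
with `F n ∈ strictSet (A n)`. The first family forces membership in `V`, and `A (n + 1)` forces
membership in `f n`. Density provides `F (n + 1)` in the open set of maps that satisfy `A n`
strictly and whose `n`-jets are `2⁻ⁿ`-close to those of `F n` in the charts of `A n`. The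
derivatives of each order are then uniformly Cauchy over each compactum, so `exists_limit` gives a
smooth pointwise limit in all `weakSet (A n)`. Convergence in the Whitney topology is never needed.

Pointwise convergence also preserves the relative constraints, because the image of each `Y(s)` is
closed in `|Y|`. -/

lemma uniformCauchySeqOn_of_le_geometric {α β : Type*} [PseudoMetricSpace β] {s : Set α}
    {u : ℕ → α → β} (N : ℕ)
    (h : ∀ m ≥ N, ∀ x ∈ s, dist (u m x) (u (m + 1) x) ≤ (1 / 2) ^ m) :
    UniformCauchySeqOn u atTop s := by
  -- The subtracted tail of the geometric series is what makes the induction on `j` close.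
  have key : ∀ m ≥ N, ∀ x ∈ s, ∀ j, dist (u m x) (u (m + j) x) ≤
      2 * (1 / 2 : ℝ) ^ m - 2 * (1 / 2) ^ (m + j) := by
    intro m hm x hx j
    induction j with
    | zero => simp
    | succ j ih =>
      have h1 := dist_triangle (u m x) (u (m + j) x) (u (m + j + 1) x)
      have h2 := h (m + j) (by omega) x hx
      have h3 : (1 / 2 : ℝ) ^ (m + (j + 1)) = (1 / 2) ^ (m + j) * (1 / 2) := by
        rw [← add_assoc, pow_succ]
      rw [← add_assoc] at h3 ⊢
      linarith
  have key' : ∀ m ≥ N, ∀ x ∈ s, ∀ n ≥ m, dist (u m x) (u n x) ≤ 2 * (1 / 2 : ℝ) ^ m := by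
    intro m hm x hx n hn
    obtain ⟨j, rfl⟩ := Nat.exists_eq_add_of_le hn
    have := key m hm x hx j
    have h2 : (0 : ℝ) < (1 / 2) ^ (m + j) := by positivity
    linarith
  rw [Metric.uniformCauchySeqOn_iff]
  intro ε hε
  obtain ⟨M, hM⟩ := exists_pow_lt_of_lt_one (show 0 < ε / 4 by positivity)
    (show (1 / 2 : ℝ) < 1 by norm_num)
  refine ⟨max N M, fun m hm n hn x hx => ?_⟩
  have h1 := key' (max N M) (le_max_left _ _) x hx m hm
  have h2 := key' (max N M) (le_max_left _ _) x hx n hn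
  have h3 : (1 / 2 : ℝ) ^ (max N M) ≤ (1 / 2) ^ M :=
    pow_le_pow_of_le_one (by norm_num) (by norm_num) (le_max_right _ _)
  have h4 := dist_triangle_left (u m x) (u n x) (u (max N M) x)
  linarith

variable {E F : Type*} [NormedAddCommGroup E] [NormedSpace ℝ E]
  [NormedAddCommGroup F] [NormedSpace ℝ F]

/-- Termwise differentiation of a sequence of functions on a convex set whose derivatives within
the set converge uniformly. -/
lemma hasFDerivWithinAt_of_tendstoUniformlyOn_of_convex {s : Set E} (hs : Convex ℝ s)
    {f : ℕ → E → F} {f' : ℕ → E → E →L[ℝ] F} {g : E → F} {g' : E → E →L[ℝ] F}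
    (hf : ∀ᶠ n in atTop, ∀ x ∈ s, HasFDerivWithinAt (f n) (f' n x) s x)
    (hf' : TendstoUniformlyOn f' g' atTop s)
    (hg : ∀ x ∈ s, Tendsto (fun n => f n x) atTop (𝓝 (g x))) {x : E} (hx : x ∈ s) :
    HasFDerivWithinAt g (g' x) s x := by
  rw [hasFDerivWithinAt_iff_isLittleO, Asymptotics.isLittleO_iff]
  intro ε hε
  have hε4 : 0 < ε / 4 := by positivity
  obtain ⟨N, hN⟩ := eventually_atTop.1 (hf.and (Metric.tendstoUniformlyOn_iff.1 hf' _ hε4))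
  -- Mean value inequality on the convex set for `f m - f N`, whose derivative is at most `ε / 4 + ε
  -- / 4`. Letting `m` tend to infinity gives the same bound for `g - f N`.
  have h1 : ∀ m ≥ N, ∀ y ∈ s,
      ‖(f m y - f N y) - (f m x - f N x)‖ ≤ (ε / 2) * ‖y - x‖ := by
    intro m hm y hy
    refine hs.norm_image_sub_le_of_norm_hasFDerivWithin_le (f := fun z => f m z - f N z)
      (f' := fun z => f' m z - f' N z)
      (fun z hz => ((hN m hm).1 z hz).sub ((hN N le_rfl).1 z hz)) (fun z hz => ?_) hx hy
    have h2 := (hN m hm).2 z hz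
    have h3 := (hN N le_rfl).2 z hz
    rw [← dist_eq_norm]
    have := dist_triangle_left (f' m z) (f' N z) (g' z)
    linarith
  have h2 : ∀ y ∈ s, ‖(g y - f N y) - (g x - f N x)‖ ≤ (ε / 2) * ‖y - x‖ := by
    intro y hy
    refine le_of_tendsto ((((hg y hy).sub_const _).sub ((hg x hx).sub_const _)).norm)
      (eventually_atTop.2 ⟨N, fun m hm => h1 m hm y hy⟩)
  have h3 := (Asymptotics.isLittleO_iff.1
    (hasFDerivWithinAt_iff_isLittleO.1 ((hN N le_rfl).1 x hx))) hε4
  filter_upwards [h3, self_mem_nhdsWithin] with y hy hys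
  have h4 : ‖(f' N x - g' x) (y - x)‖ ≤ (ε / 4) * ‖y - x‖ := by
    refine ((f' N x - g' x).le_opNorm _).trans ?_
    have := (hN N le_rfl).2 x hx
    rw [dist_comm, dist_eq_norm] at this
    gcongr
  have h5 : g y - g x - g' x (y - x) = ((g y - f N y) - (g x - f N x)) +
      (f N y - f N x - f' N x (y - x)) + (f' N x - g' x) (y - x) := by
    simp only [sub_apply]
    abel
  rw [h5]
  have h6 := h2 y hys
  refine (norm_add₃_le).trans ?_
  linarith

/-- A pointwise limit of smooth functions on a convex set whose derivatives of all orders form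
uniform Cauchy sequences is smooth, and the derivatives converge to those of the limit. -/
lemma contDiffOn_and_tendsto_of_uniformCauchySeqOn [CompleteSpace F] {s : Set E}
    (hs : Convex ℝ s) (hu : UniqueDiffOn ℝ s) {f : ℕ → E → F} {g : E → F}
    (hf : ∀ᶠ n in atTop, ContDiffOn ℝ ∞ (f n) s)
    (hc : ∀ k : ℕ, UniformCauchySeqOn (fun n => iteratedFDerivWithin ℝ k (f n) s) atTop s)
    (hg : ∀ x ∈ s, Tendsto (fun n => f n x) atTop (𝓝 (g x))) :
    ContDiffOn ℝ ∞ g s ∧ ∀ k : ℕ, ∀ x ∈ s,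
      Tendsto (fun n => iteratedFDerivWithin ℝ k (f n) s x) atTop
        (𝓝 (iteratedFDerivWithin ℝ k g s x)) := by
  have hlim : ∀ (k : ℕ) (x : E), ∃ a : E [×k]→L[ℝ] F, x ∈ s →
      Tendsto (fun n => iteratedFDerivWithin ℝ k (f n) s x) atTop (𝓝 a) := by
    intro k x
    by_cases hx : x ∈ s
    · obtain ⟨a, ha⟩ := cauchySeq_tendsto_of_complete ((hc k).cauchySeq hx)
      exact ⟨a, fun _ => ha⟩
    · exact ⟨0, fun h => absurd h hx⟩
  choose P hP using hlim
  have hunif : ∀ k, TendstoUniformlyOn (fun n => iteratedFDerivWithin ℝ k (f n) s) (P k) atTop s :=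
    fun k => (hc k).tendstoUniformlyOn_of_tendsto (hP k)
  -- The limits of the derivatives form a Taylor series of `g`. Unique differentiability then
  -- identifies them with its derivatives.
  have hT : HasFTaylorSeriesUpToOn ∞ g (fun x k => P k x) s := by
    refine ⟨fun x hx => ?_, fun m _ x hx => ?_, fun m _ => ?_⟩
    · have h1 := ((continuousMultilinearCurryFin0 ℝ E F).continuous.tendsto _).comp (hP 0 x hx)
      refine tendsto_nhds_unique h1 ?_
      simpa [Function.comp_def] using hg x hx
    · refine hasFDerivWithinAt_of_tendstoUniformlyOn_of_convex hs
        (f := fun n => iteratedFDerivWithin ℝ m (f n) s)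
        (f' := fun n x => (iteratedFDerivWithin ℝ (m + 1) (f n) s x).curryLeft) (g := P m)
        (g' := fun x => (P (m + 1) x).curryLeft) ?_ ?_ (fun y hy => hP m y hy) hx
      · filter_upwards [hf] with n hn y hy
        exact (hn.ftaylorSeriesWithin hu).fderivWithin m (by exact_mod_cast WithTop.coe_lt_top m)
          y hy
      · exact (continuousMultilinearCurryLeftEquiv ℝ (fun _ : Fin (m + 1) => E)
          F).isometry.uniformContinuous.comp_tendstoUniformlyOn (hunif (m + 1))
    · refine (hunif m).continuousOn (Eventually.frequently ?_)
      filter_upwards [hf] with n hn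
      exact hn.continuousOn_iteratedFDerivWithin (by exact_mod_cast le_top) hu
  refine ⟨hT.contDiffOn, fun k x hx => ?_⟩
  rw [← hT.eq_iteratedFDerivWithin_of_uniqueDiffOn (by exact_mod_cast le_top) hu hx]
  exact hP k x hx

end UniformLimits

/-! ### Jets of maps as derivatives in charts -/

section Coordinates

variable {X : MfdCorners.{u}} {Y : MfdCorners.{v}}

/-- The `i`-th coordinate of `G` read in the charts `φ` and `ψ`. -/
def localRep (φ : Chart X) (ψ : Chart Y) (G : X → Y) (i : Fin Y.dim) (x : X.E) : ℝ :=
  ψ.1.extend Y.I (G ((φ.1.extend X.I).symm x)) i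

/-- The coordinates of the `r`-jet of `G` at `p` with respect to `φ` and `ψ`. -/
def mapCoord (r : ℕ) (φ : Chart X) (ψ : Chart Y) (G : X → Y) (p : X) : JetCoord X Y r :=
  (φ.1 p, ψ.1 (G p), fun i k =>
    iteratedFDerivWithin ℝ k (fun x => localRep φ ψ G i x - ψ.1.extend Y.I (G p) i)
      (range X.I) (φ.1.extend X.I p))

lemma mapCoord_zero {r : ℕ} {φ : Chart X} {ψ : Chart Y} (G : X → Y) {p : X}
    (hp : p ∈ φ.1.source) (i : Fin Y.dim) (k : Fin (r + 1)) (hk : (k : ℕ) = 0) :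
    (mapCoord r φ ψ G p).2.2 i k = 0 := by
  obtain ⟨k, hk'⟩ := k
  obtain rfl : k = 0 := hk
  rw [← norm_eq_zero]
  simp only [mapCoord, norm_iteratedFDerivWithin_zero, localRep, φ.1.extend_left_inv hp, sub_self,
    norm_zero]

lemma iteratedFDerivWithin_sub_const_of_ne_zero {E F : Type*} [NormedAddCommGroup E]
    [NormedSpace ℝ E] [NormedAddCommGroup F] [NormedSpace ℝ F] (f : E → F) (c : F) {s : Set E}
    (hs : UniqueDiffOn ℝ s) {x : E} (hx : x ∈ s) {k : ℕ} (hk : k ≠ 0) :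
    iteratedFDerivWithin ℝ k (fun y => f y - c) s x = iteratedFDerivWithin ℝ k f s x := by
  obtain ⟨k, rfl⟩ := Nat.exists_eq_succ_of_ne_zero hk
  simp only [Nat.succ_eq_add_one, iteratedFDerivWithin_succ_eq_comp_right hs hx,
    fderivWithin_sub_const, Function.comp_apply]

/-- The constant subtracted in `mapCoord` depends on `p`. In positive order it disappears, leaving
derivatives of one function independent of `p`, to which continuity and limit arguments apply. -/
lemma mapCoord_of_ne_zero {r : ℕ} (φ : Chart X) (ψ : Chart Y) (G : X → Y) (p : X)
    (i : Fin Y.dim) (k : Fin (r + 1)) (hk : (k : ℕ) ≠ 0) :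
    (mapCoord r φ ψ G p).2.2 i k =
      iteratedFDerivWithin ℝ k (localRep φ ψ G i) (range X.I) (φ.1.extend X.I p) :=
  iteratedFDerivWithin_sub_const_of_ne_zero _ _ X.I.uniqueDiffOn (mem_range_self _) hk

/-- An open subset of `X`, read in the chart `φ`, is relatively open in the quadrant. -/
lemma exists_isOpen_chart (φ : Chart X) {U : Set X} (hU : IsOpen U) :
    ∃ o : Set X.E, IsOpen o ∧ (∀ p ∈ φ.1.source ∩ U, φ.1.extend X.I p ∈ o) ∧
      ∀ x ∈ range X.I ∩ o, x ∈ (φ.1.extend X.I).target ∧ (φ.1.extend X.I).symm x ∈ U := by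
  refine ⟨X.I.symm ⁻¹' (φ.1.target ∩ φ.1.symm ⁻¹' U),
    (φ.1.symm.isOpen_inter_preimage hU).preimage X.I.continuous_symm,
    fun p hp => ?_, fun x hx => ⟨?_, ?_⟩⟩
  · simp only [mem_preimage, OpenPartialHomeomorph.extend_coe, Function.comp_apply,
      ModelWithCorners.left_inv]
    exact ⟨φ.1.map_source hp.1, by simpa [φ.1.left_inv hp.1] using hp.2⟩
  · rw [OpenPartialHomeomorph.extend_target]
    exact ⟨hx.2.1, hx.1⟩
  · simpa using hx.2.2

lemma contDiffOn_localRep (φ : Chart X) (ψ : Chart Y) (G : SmoothMap X Y) (i : Fin Y.dim)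
    {s : Set X.E} (hs : ∀ x ∈ s, x ∈ (φ.1.extend X.I).target ∧
      G ((φ.1.extend X.I).symm x) ∈ ψ.1.source) :
    ContDiffOn ℝ ∞ (localRep φ ψ G i) s := by
  rw [← contMDiffOn_iff_contDiffOn]
  intro x hx
  have h2 : ContMDiffWithinAt 𝓘(ℝ, X.E) X.I ∞ (φ.1.extend X.I).symm s x :=
    ((contMDiffOn_extend_symm φ.2).mono (fun y hy => by
      have := (hs y hy).1
      rwa [OpenPartialHomeomorph.extend_target'] at this)) x hx
  have h3 : ContMDiffWithinAt 𝓘(ℝ, X.E) Y.I ∞ (G ∘ (φ.1.extend X.I).symm) s x :=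
    ContMDiffAt.comp_contMDiffWithinAt x G.contMDiff.contMDiffAt h2
  have h4 := ψ.1.contMDiffAt_extend ψ.2 (hs x hx).2
  have h5 : ContMDiffWithinAt 𝓘(ℝ, X.E) 𝓘(ℝ, Y.E) ∞
      (ψ.1.extend Y.I ∘ G ∘ (φ.1.extend X.I).symm) s x :=
    ContMDiffAt.comp_contMDiffWithinAt x h4 h3
  have h6 : ContDiff ℝ ∞ (fun v : Y.E => v i) := by fun_prop
  exact ContMDiffAt.comp_contMDiffWithinAt x h6.contMDiff.contMDiffAt h5

lemma continuousOn_mapCoord (r : ℕ) (φ : Chart X) (ψ : Chart Y) (G : SmoothMap X Y) :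
    ContinuousOn (mapCoord r φ ψ G) (φ.1.source ∩ G ⁻¹' ψ.1.source) := by
  have hG := G.contMDiff.continuous
  refine (φ.1.continuousOn.mono inter_subset_left).prodMk
    ((ψ.1.continuousOn.comp hG.continuousOn (fun p hp => hp.2)).prodMk ?_)
  refine continuousOn_pi.2 fun i => continuousOn_pi.2 fun k => ?_
  by_cases hk : (k : ℕ) = 0
  · exact continuousOn_const.congr (fun p hp => mapCoord_zero G hp.1 i k hk)
  · refine ContinuousOn.congr ?_ (fun p _ => mapCoord_of_ne_zero φ ψ G p i k hk)
    obtain ⟨o, ho, hpo, hs⟩ := exists_isOpen_chart φ (ψ.1.open_source.preimage hG)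
    have h1 := (contDiffOn_localRep φ ψ G i hs).continuousOn_iteratedFDerivWithin
      (m := k) (by exact_mod_cast le_top) (X.I.uniqueDiffOn.inter ho)
    have h2 := h1.comp ((φ.1.continuousOn_extend (I := X.I)).mono
      (by rw [OpenPartialHomeomorph.extend_source]; exact inter_subset_left))
      (fun p (hp : p ∈ φ.1.source ∩ G ⁻¹' ψ.1.source) =>
        ⟨mem_range_self _, hpo p hp⟩)
    refine h2.congr fun p hp => ?_
    exact (iteratedFDerivWithin_inter_open ho (hpo p hp)).symm

/-- The basic open subsets of the jet bundle. -/
def basicJets (r : ℕ) (φ : Chart X) (ψ : Chart Y) (O : Set (JetCoord X Y r)) :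
    Set (JetBundle X Y r) :=
  {j | ∃ (hp : j.src ∈ φ.1.source) (hq : j.tgt ∈ ψ.1.source), jetCoord r φ ψ j hp hq ∈ O}

lemma isOpen_basicJets (r : ℕ) (φ : Chart X) (ψ : Chart Y) {O : Set (JetCoord X Y r)}
    (hO : IsOpen O) : IsOpen (basicJets r φ ψ O) :=
  TopologicalSpace.isOpen_generateFrom_of_mem ⟨φ, ψ, O, hO, rfl⟩

/-- Pull-back of germs and Taylor coefficients are both computed on representatives, so the
coordinates of `jet r G p` unfold to `mapCoord`. -/
lemma jet_mem_basicJets {r : ℕ} {φ : Chart X} {ψ : Chart Y} {O : Set (JetCoord X Y r)}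
    {G : SmoothMap X Y} {p : X} : jet r G p ∈ basicJets r φ ψ O ↔
      p ∈ φ.1.source ∧ G p ∈ ψ.1.source ∧ mapCoord r φ ψ G p ∈ O :=
  ⟨fun ⟨hp, hq, h⟩ => ⟨hp, hq, h⟩, fun ⟨hp, hq, h⟩ => ⟨hp, hq, h⟩⟩

/-- The preferred chart at `p` as an element of the maximal atlas. -/
def chartAtlas (p : X) : Chart X := ⟨chartAt X.H p, IsManifold.chart_mem_maximalAtlas p⟩

lemma mem_chartAtlas_source (p : X) : p ∈ (chartAtlas p).1.source := mem_chart_source X.H p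

lemma continuous_src (r : ℕ) : Continuous (JetBundle.src : JetBundle X Y r → X) := by
  refine continuous_def.2 fun W hW => isOpen_iff_mem_nhds.2 fun j hj => ?_
  refine mem_of_superset ((isOpen_basicJets r (chartAtlas j.src) (chartAtlas j.tgt)
    (O := Prod.fst ⁻¹' ((chartAtlas j.src).1.target ∩ (chartAtlas j.src).1.symm ⁻¹' W))
    (((chartAtlas j.src).1.symm.isOpen_inter_preimage hW).preimage continuous_fst)).mem_nhds
    ⟨mem_chartAtlas_source _, mem_chartAtlas_source _, ?_⟩) ?_
  · refine ⟨(chartAtlas j.src).1.map_source (mem_chartAtlas_source _), ?_⟩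
    simpa [jetCoord, (chartAtlas j.src).1.left_inv (mem_chartAtlas_source _)] using hj
  · rintro j' ⟨hp, hq, h⟩
    simpa [jetCoord, (chartAtlas j.src).1.left_inv hp] using h.2

lemma continuous_jet (r : ℕ) (G : SmoothMap X Y) : Continuous (jet r G) := by
  refine continuous_generateFrom_iff.2 ?_
  rintro _ ⟨φ, ψ, O, hO, rfl⟩
  have h := (continuousOn_mapCoord r φ ψ G).isOpen_inter_preimage
    (φ.1.open_source.inter (ψ.1.open_source.preimage G.contMDiff.continuous)) hO
  convert h using 1
  ext p
  exact jet_mem_basicJets.trans and_assoc.symm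

/-- Imposing open conditions on jets over a locally finite family of closed sets is an open
condition. -/
lemma isOpen_jets_of_locallyFinite {ι : Type*} (r : ℕ) (A : Set ι) (K : ι → Set X)
    (U : ι → Set (JetBundle X Y r)) (hK : ∀ i ∈ A, IsClosed (K i)) (hU : ∀ i ∈ A, IsOpen (U i))
    (hA : ∀ p, ∃ t ∈ 𝓝 p, {i ∈ A | (K i ∩ t).Nonempty}.Finite) :
    IsOpen {j : JetBundle X Y r | ∀ i ∈ A, j.src ∈ K i → j ∈ U i} := by
  refine isOpen_iff_mem_nhds.2 fun j hj => ?_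
  obtain ⟨t, ht, hfin⟩ := hA j.src
  -- Only finitely many conditions are visible over `t`. Each is open, being the union of the
  -- complement of a closed set of sources and `U i`.
  have h1 : (⋂ i ∈ {i ∈ A | (K i ∩ t).Nonempty}, (JetBundle.src ⁻¹' (K i)ᶜ ∪ U i)) ∈ 𝓝 j := by
    refine (biInter_mem hfin).2 fun i hi => ?_
    refine (((hK i hi.1).isOpen_compl.preimage (continuous_src r)).union (hU i hi.1)).mem_nhds ?_
    by_cases h : j.src ∈ K i
    · exact Or.inr (hj i hi.1 h)
    · exact Or.inl h
  filter_upwards [h1, (continuous_src r).continuousAt.preimage_mem_nhds ht] with j' h2 h3 i hi hjK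
  rcases mem_iInter₂.1 h2 i ⟨hi, _, hjK, h3⟩ with h | h
  · exact absurd hjK h
  · exact h

lemma isOpen_whitney {r : ℕ} {U : Set (JetBundle X Y r)} (hU : IsOpen U) :
    IsOpen {F : SmoothMap X Y | ∀ p, jet r F p ∈ U} :=
  TopologicalSpace.isOpen_generateFrom_of_mem ⟨r, U, hU, rfl⟩

end Coordinates

/-! ### Closed jet conditions and Whitney neighbourhoods -/

section Conditions

variable {X : MfdCorners.{u}} {Y : MfdCorners.{v}}

/-- The components of jet coordinates which determine the map. -/
def jetVec (Y : MfdCorners.{v}) {n : ℕ} (z : JetCoord X Y n) :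
    Y.E × (Fin Y.dim → ∀ k : Fin (n + 1), X.E [×k]→L[ℝ] ℝ) :=
  (Y.I z.2.1, z.2.2)

lemma continuous_jetVec {n : ℕ} : Continuous (jetVec Y : JetCoord X Y n → _) :=
  (Y.I.continuous.comp (by fun_prop)).prodMk (by fun_prop)

/-- A closed condition on the jets of maps over a compact subset of a chart domain. -/
structure JetCondition (X : MfdCorners.{u}) (Y : MfdCorners.{v}) where
  K : Set X
  φ : Chart X
  ψ : Chart Y
  r : ℕ
  C : Set (JetCoord X Y r)
  isCompact_K : IsCompact K
  subset_source : K ⊆ φ.1.source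
  isClosed_C : IsClosed C
  exists_isCompact : ∃ L : Set Y.H, IsCompact L ∧ L ⊆ ψ.1.target ∧ ∀ z ∈ C, z.2.1 ∈ L

namespace JetCondition

/-- `G` satisfies the condition `c` at `p`. -/
def Holds (c : JetCondition X Y) (G : X → Y) (p : X) : Prop :=
  G p ∈ c.ψ.1.source ∧ mapCoord c.r c.φ c.ψ G p ∈ c.C

/-- `G` satisfies the condition `c` at `p` in a stable way. -/
def HoldsStrictly (c : JetCondition X Y) (G : X → Y) (p : X) : Prop :=
  G p ∈ c.ψ.1.source ∧ mapCoord c.r c.φ c.ψ G p ∈ interior c.C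

lemma HoldsStrictly.holds {c : JetCondition X Y} {G : X → Y} {p : X}
    (h : c.HoldsStrictly G p) : c.Holds G p :=
  ⟨h.1, interior_subset h.2⟩

/-- The smooth maps which satisfy all conditions of a family in the interiors of their compacta. -/
def weakSet (A : Set (JetCondition X Y)) : Set (SmoothMap X Y) :=
  {G | ∀ c ∈ A, ∀ p ∈ interior c.K, c.Holds G p}

/-- The smooth maps which satisfy all conditions of a family strictly. -/
def strictSet (A : Set (JetCondition X Y)) : Set (SmoothMap X Y) :=
  {G | ∀ c ∈ A, ∀ p ∈ c.K, c.HoldsStrictly G p}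

lemma weakSet_anti {A B : Set (JetCondition X Y)} (h : A ⊆ B) : weakSet B ⊆ weakSet A :=
  fun _ hG c hc => hG c (h hc)

/-- Locally finite families of conditions of bounded order over a cover of `X`. -/
structure Admissible (A : Set (JetCondition X Y)) : Prop where
  locallyFinite : ∀ p, ∃ t ∈ 𝓝 p, {c ∈ A | (c.K ∩ t).Nonempty}.Finite
  bounded : ∃ R, ∀ c ∈ A, c.r ≤ R
  cover : ∀ p, ∃ c ∈ A, p ∈ interior c.K

lemma Admissible.union {A B : Set (JetCondition X Y)} (hA : Admissible A) (hB : Admissible B) :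
    Admissible (A ∪ B) where
  locallyFinite p := by
    obtain ⟨s, hs, hs'⟩ := hA.locallyFinite p
    obtain ⟨t, ht, ht'⟩ := hB.locallyFinite p
    refine ⟨s ∩ t, inter_mem hs ht, (hs'.union ht').subset ?_⟩
    rintro c ⟨hc | hc, hne⟩
    · exact Or.inl ⟨hc, hne.mono (inter_subset_inter_right _ inter_subset_left)⟩
    · exact Or.inr ⟨hc, hne.mono (inter_subset_inter_right _ inter_subset_right)⟩
  bounded := by
    obtain ⟨R, hR⟩ := hA.bounded
    obtain ⟨R', hR'⟩ := hB.bounded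
    exact ⟨max R R', fun c hc => hc.elim (fun h => (hR c h).trans (le_max_left _ _))
      (fun h => (hR' c h).trans (le_max_right _ _))⟩
  cover p := by
    obtain ⟨c, hc, hp⟩ := hA.cover p
    exact ⟨c, Or.inl hc, hp⟩

/-- A subbasic Whitney open set concerns a single jet order, so the conditions are sorted by order.
Local finiteness handles each order, and the bound on the orders makes the intersection finite. -/
lemma isOpen_strictSet {A : Set (JetCondition X Y)} (hA : Admissible A) :
    IsOpen (strictSet A) := by
  obtain ⟨R, hR⟩ := hA.bounded
  have heq : strictSet A = ⋂ r ∈ Iic R, {G | ∀ p, jet r G p ∈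
      {j : JetBundle X Y r | ∀ c ∈ {c ∈ A | c.r = r}, j.src ∈ c.K →
        j ∈ {j | ∃ h : c.r = r, j ∈ basicJets r c.φ c.ψ (h ▸ interior c.C)}}} := by
    ext G
    simp only [mem_iInter]
    constructor
    · rintro hG _ - p c ⟨hc, rfl⟩ hp
      exact ⟨rfl, jet_mem_basicJets.2 ⟨c.subset_source hp, hG c hc p hp⟩⟩
    · intro hG c hc p hp
      obtain ⟨_, h⟩ := hG c.r (hR c hc) p c ⟨hc, rfl⟩ hp
      exact (jet_mem_basicJets.1 h).2
  rw [heq]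
  refine (finite_Iic R).isOpen_biInter fun r _ => isOpen_whitney
    (isOpen_jets_of_locallyFinite r {c ∈ A | c.r = r} JetCondition.K _
      (fun c _ => c.isCompact_K.isClosed) ?_ fun p => ?_)
  · rintro c ⟨-, rfl⟩
    convert isOpen_basicJets c.r c.φ c.ψ (isOpen_interior (s := c.C)) using 1
    ext j
    exact exists_prop_of_true rfl
  · obtain ⟨t, ht, h⟩ := hA.locallyFinite p
    exact ⟨t, ht, h.subset fun c hc => ⟨hc.1.1, hc.2⟩⟩

/-- The smooth maps whose jets of order `n` are `ε`-close to those of `F` in all charts of the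
family `A`. -/
def closeSet (A : Set (JetCondition X Y)) (F : SmoothMap X Y) (n : ℕ) (ε : ℝ) :
    Set (SmoothMap X Y) :=
  {G | ∀ c ∈ A, ∀ p ∈ c.K, G p ∈ c.ψ.1.source ∧
    dist (jetVec Y (mapCoord n c.φ c.ψ F p)) (jetVec Y (mapCoord n c.φ c.ψ G p)) < ε}

lemma self_mem_closeSet {A : Set (JetCondition X Y)} {F : SmoothMap X Y} (hF : F ∈ strictSet A)
    (n : ℕ) {ε : ℝ} (hε : 0 < ε) : F ∈ closeSet A F n ε :=
  fun c hc p hp => ⟨(hF c hc p hp).1, by rwa [dist_self]⟩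

/-- The source coordinate of a jet recovers the point at which the jet of `F` must be compared with
it. Closeness to `F` is thus an open condition on the jet alone. -/
lemma isOpen_closeSet {A : Set (JetCondition X Y)} (hA : Admissible A) {F : SmoothMap X Y}
    (hF : F ∈ strictSet A) (n : ℕ) (ε : ℝ) : IsOpen (closeSet A F n ε) := by
  let N : JetCondition X Y → Set X.H := fun c =>
    c.φ.1.target ∩ c.φ.1.symm ⁻¹' (F ⁻¹' c.ψ.1.source)
  have hN : ∀ c, IsOpen (N c) := fun c => c.φ.1.symm.isOpen_inter_preimage
    (c.ψ.1.open_source.preimage F.contMDiff.continuous)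
  let O : JetCondition X Y → Set (JetCoord X Y n) := fun c => Prod.fst ⁻¹' N c ∩
    (fun z => dist (jetVec Y (mapCoord n c.φ c.ψ F (c.φ.1.symm z.1))) (jetVec Y z)) ⁻¹' Iio ε
  have hO : ∀ c, IsOpen (O c) := by
    intro c
    refine ContinuousOn.isOpen_inter_preimage ?_ ((hN c).preimage continuous_fst) isOpen_Iio
    refine continuous_dist.comp_continuousOn (ContinuousOn.prodMk
      (continuous_jetVec.comp_continuousOn ?_) continuous_jetVec.continuousOn)
    refine (continuousOn_mapCoord n c.φ c.ψ F).comp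
      (c.φ.1.symm.continuousOn.comp continuousOn_fst fun z hz => hz.1) fun z hz => ?_
    exact ⟨c.φ.1.map_target hz.1, hz.2⟩
  have h : closeSet A F n ε = {G | ∀ p, jet n G p ∈
      {j : JetBundle X Y n | ∀ c ∈ A, j.src ∈ c.K → j ∈ basicJets n c.φ c.ψ (O c)}} := by
    ext G
    have key : ∀ c ∈ A, ∀ p ∈ c.K, (mapCoord n c.φ c.ψ G p ∈ O c ↔
        dist (jetVec Y (mapCoord n c.φ c.ψ F p)) (jetVec Y (mapCoord n c.φ c.ψ G p)) < ε) := by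
      intro c hc p hp
      have hp' := c.subset_source hp
      have h1 : c.φ.1 p ∈ N c :=
        ⟨c.φ.1.map_source hp', by simpa [c.φ.1.left_inv hp'] using (hF c hc p hp).1⟩
      have h2 : c.φ.1.symm (mapCoord n c.φ c.ψ G p).1 = p := c.φ.1.left_inv hp'
      simp only [O, mem_inter_iff, mem_preimage, mem_Iio, h2]
      exact ⟨fun h => h.2, fun h => ⟨h1, h⟩⟩
    constructor
    · intro hG p c hc hp
      exact jet_mem_basicJets.2 ⟨c.subset_source hp, (hG c hc p hp).1,
        (key c hc p hp).2 (hG c hc p hp).2⟩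
    · intro hG c hc p hp
      have := jet_mem_basicJets.1 (hG p c hc hp)
      exact ⟨this.2.1, (key c hc p hp).1 this.2.2⟩
  rw [h]
  exact isOpen_whitney (isOpen_jets_of_locallyFinite n A JetCondition.K _
    (fun c _ => c.isCompact_K.isClosed) (fun c _ => isOpen_basicJets n c.φ c.ψ (hO c))
    hA.locallyFinite)

/-- The jet coordinates of `F` over `K` form a compact set, which has a neighbourhood with closure
in `O`. That closure serves as `C`, and a compact neighbourhood of the target coordinates serves as
`L`. -/
lemma exists_of_basicJets {r : ℕ} {φ : Chart X} {ψ : Chart Y} {O : Set (JetCoord X Y r)}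
    (hO : IsOpen O) {K : Set X} (hK : IsCompact K) (F : SmoothMap X Y)
    (hF : ∀ p ∈ K, jet r F p ∈ basicJets r φ ψ O) :
    ∃ c : JetCondition X Y, c.K = K ∧ c.r = r ∧ (∀ p ∈ K, c.HoldsStrictly F p) ∧
      ∀ G : SmoothMap X Y, ∀ p ∈ K, c.Holds G p → jet r G p ∈ basicJets r φ ψ O := by
  simp only [jet_mem_basicJets] at hF
  have hT : IsCompact (mapCoord r φ ψ F '' K) := hK.image_of_continuousOn
    ((continuousOn_mapCoord r φ ψ F).mono fun p hp => ⟨(hF p hp).1, (hF p hp).2.1⟩)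
  have hL0 : IsCompact ((fun p => ψ.1 (F p)) '' K) := hK.image_of_continuousOn
    (ψ.1.continuousOn.comp F.contMDiff.continuous.continuousOn fun p hp => (hF p hp).2.1)
  have : RegularSpace X.H := X.I.isClosedEmbedding.isInducing.regularSpace
  have : RegularSpace Y.H := Y.I.isClosedEmbedding.isInducing.regularSpace
  have : LocallyCompactSpace Y.H := Y.I.locallyCompactSpace
  obtain ⟨L, hL, hL1, hL2⟩ := exists_compact_between hL0 ψ.1.open_target (by
    rintro _ ⟨p, hp, rfl⟩
    exact ψ.1.map_source (hF p hp).2.1)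
  have hO' : IsOpen (O ∩ (fun z : JetCoord X Y r => z.2.1) ⁻¹' interior L) :=
    hO.inter (isOpen_interior.preimage (by fun_prop))
  obtain ⟨V, hV, hTV, hVO⟩ := hT.exists_isOpen_closure_subset (hO'.mem_nhdsSet.2 (by
    rintro _ ⟨p, hp, rfl⟩
    exact ⟨(hF p hp).2.2, hL1 ⟨p, hp, rfl⟩⟩))
  refine ⟨⟨K, φ, ψ, r, closure V, hK, fun p hp => (hF p hp).1, isClosed_closure, L, hL, hL2,
    fun z hz => interior_subset (hVO hz).2⟩, rfl, rfl, fun p hp => ⟨(hF p hp).2.1, ?_⟩,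
    fun G p hp h => ?_⟩
  · exact interior_maximal subset_closure hV (hTV ⟨p, hp, rfl⟩)
  · exact jet_mem_basicJets.2 ⟨(hF p hp).1, h.1, (hVO h.2).1⟩

lemma exists_finite_basicJets {r : ℕ} {U : Set (JetBundle X Y r)} (hU : IsOpen U)
    {j : JetBundle X Y r} (hj : j ∈ U) :
    ∃ f : Set (Chart X × Chart Y × Set (JetCoord X Y r)), f.Finite ∧ f.Nonempty ∧
      (∀ t ∈ f, IsOpen t.2.2 ∧ j ∈ basicJets r t.1 t.2.1 t.2.2) ∧
      ⋂ t ∈ f, basicJets r t.1 t.2.1 t.2.2 ⊆ U := by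
  obtain ⟨_, ⟨f, ⟨hf, hfs⟩, rfl⟩, hjf, hfU⟩ :=
    (TopologicalSpace.isTopologicalBasis_of_subbasis (t := instTopologicalSpaceJetBundle r)
      rfl).mem_nhds_iff.1 (hU.mem_nhds hj)
  have h : ∃ g ⊆ {t : Chart X × Chart Y × Set (JetCoord X Y r) | IsOpen t.2.2}, g.Finite ∧
      (fun t => basicJets r t.1 t.2.1 t.2.2) '' g = f := by
    refine (exists_subset_image_finite_and (p := fun g => g = f)).1 ⟨f, fun W hW => ?_, hf, rfl⟩
    obtain ⟨φ, ψ, O, hO, rfl⟩ := hfs hW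
    exact ⟨(φ, ψ, O), hO, rfl⟩
  obtain ⟨g, hg, hgf, rfl⟩ := h
  -- The trivial triple ensures that the family is nonempty, so that at least one condition is
  -- imposed near each point and the compacta cover `X`.
  refine ⟨insert (chartAtlas j.src, chartAtlas j.tgt, univ) g, hgf.insert _, insert_nonempty _ _,
    ?_, ?_⟩
  · rintro t (rfl | ht)
    · exact ⟨isOpen_univ, mem_chartAtlas_source _, mem_chartAtlas_source _, mem_univ _⟩
    · exact ⟨hg ht, hjf _ ⟨t, ht, rfl⟩⟩
  · refine subset_trans ?_ hfU
    rintro j' hj' _ ⟨t, ht, rfl⟩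
    exact mem_iInter₂.1 hj' t (Or.inr ht)

lemma exists_admissible_of_isOpen {r : ℕ} {U : Set (JetBundle X Y r)} (hU : IsOpen U)
    {F : SmoothMap X Y} (hF : ∀ p, jet r F p ∈ U) :
    ∃ A, Admissible A ∧ F ∈ strictSet A ∧ weakSet A ⊆ {G | ∀ p, jet r G p ∈ U} := by
  choose f hf hne hmem hsub using fun p => exists_finite_basicJets hU (hF p)
  let N : X → Set X := fun p => ⋂ t ∈ f p, jet r F ⁻¹' basicJets r t.1 t.2.1 t.2.2
  have hN : ∀ p, N p ∈ 𝓝 p := fun p => (biInter_mem (hf p)).2 fun t ht =>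
    (continuous_jet r F).continuousAt.preimage_mem_nhds
      ((isOpen_basicJets r t.1 t.2.1 (hmem p t ht).1).mem_nhds (hmem p t ht).2)
  have : LocallyCompactSpace X := Manifold.locallyCompact_of_finiteDimensional X.I
  have hB : ∀ p : X, (𝓝 p).HasBasis
      (fun W : Set X => p ∈ W ∧ IsOpen W ∧ IsCompact (closure W) ∧ closure W ⊆ N p) id := by
    refine fun p => ⟨fun t => ⟨fun ht => ?_, fun ⟨W, hW, hWt⟩ =>
      mem_of_superset (hW.2.1.mem_nhds hW.1) hWt⟩⟩
    obtain ⟨K, hK, hKs, hKc⟩ := local_compact_nhds (inter_mem ht (hN p))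
    have hcl : closure (interior K) ⊆ K := closure_minimal interior_subset hKc.isClosed
    exact ⟨interior K, ⟨mem_interior_iff_mem_nhds.2 hK, isOpen_interior,
      hKc.of_isClosed_subset isClosed_closure hcl, fun x hx => (hKs (hcl hx)).2⟩,
      fun x hx => (hKs (interior_subset hx)).1⟩
  obtain ⟨α, c, W, hW, hcov, hlf⟩ := refinement_of_locallyCompact_sigmaCompact_of_nhds_basis hB
  have hex : ∀ a, ∀ t : f (c a), ∃ d : JetCondition X Y, d.K = closure (W a) ∧ d.r = r ∧
      (∀ p ∈ closure (W a), d.HoldsStrictly F p) ∧ ∀ G : SmoothMap X Y, ∀ p ∈ closure (W a),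
        d.Holds G p → jet r G p ∈ basicJets r t.1.1 t.1.2.1 t.1.2.2 := fun a t =>
    exists_of_basicJets (hmem (c a) t t.2).1 (hW a).2.2.1 F fun p hp =>
      mem_iInter₂.1 ((hW a).2.2.2 hp) t.1 t.2
  choose d hdK hdr hdF hdG using hex
  have hint : ∀ a t, ∀ p ∈ W a, p ∈ interior (d a t).K := fun a t p hp =>
    interior_maximal ((subset_closure).trans (hdK a t).ge) (hW a).2.1 hp
  refine ⟨{x | ∃ a t, d a t = x}, ⟨fun p => ?_, ⟨r, ?_⟩, fun p => ?_⟩, ?_, fun G hG p => ?_⟩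
  · obtain ⟨s, hs, hfin⟩ := hlf.closure p
    refine ⟨s, hs, (hfin.biUnion (t := fun a => range (d a)) fun a _ => ?_).subset ?_⟩
    · have := (hf (c a)).to_subtype
      exact finite_range _
    · rintro _ ⟨⟨a, t, rfl⟩, hne⟩
      rw [hdK] at hne
      exact mem_biUnion (x := a) hne ⟨t, rfl⟩
  · rintro _ ⟨a, t, rfl⟩
    exact (hdr a t).le
  · obtain ⟨a, ha⟩ := mem_iUnion.1 (hcov.ge (mem_univ p))
    obtain ⟨t, ht⟩ := hne (c a)
    exact ⟨_, ⟨a, ⟨t, ht⟩, rfl⟩, hint _ _ _ ha⟩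
  · rintro _ ⟨a, t, rfl⟩ p hp
    exact hdF a t p (hdK a t ▸ hp)
  · obtain ⟨a, ha⟩ := mem_iUnion.1 (hcov.ge (mem_univ p))
    refine hsub (c a) (mem_iInter₂.2 fun t ht => ?_)
    exact hdG a ⟨t, ht⟩ G p (subset_closure ha) (hG _ ⟨a, ⟨t, ht⟩, rfl⟩ p (hint _ _ _ ha))

/-- Every neighbourhood of `F` in the Whitney topology contains a set of maps defined by an
admissible family of conditions that `F` satisfies strictly. -/
lemma exists_admissible {F : SmoothMap X Y} {V : Set (SmoothMap X Y)} (hV : V ∈ 𝓝 F) :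
    ∃ A, Admissible A ∧ F ∈ strictSet A ∧ weakSet A ⊆ V := by
  -- Admissible families are closed under union, so the sets in question form a filter; `l ≤ 𝓝 F`
  -- need only be checked on generators.
  let l : Filter (SmoothMap X Y) :=
    { sets := {V | ∃ A, Admissible A ∧ F ∈ strictSet A ∧ weakSet A ⊆ V}
      univ_sets := by
        obtain ⟨A, hA, hF, -⟩ := exists_admissible_of_isOpen (r := 0) isOpen_univ
          (F := F) fun p => mem_univ _
        exact ⟨A, hA, hF, subset_univ _⟩
      sets_of_superset := fun ⟨A, hA, hF, h⟩ hVW => ⟨A, hA, hF, h.trans hVW⟩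
      inter_sets := fun ⟨A, hA, hF, h⟩ ⟨B, hB, hF', h'⟩ => ⟨A ∪ B, hA.union hB,
        fun c hc => hc.elim (hF c) (hF' c),
        subset_inter ((weakSet_anti subset_union_left).trans h)
          ((weakSet_anti subset_union_right).trans h')⟩ }
  have hl : l ≤ 𝓝 F := by
    rw [TopologicalSpace.nhds_generateFrom]
    refine le_iInf₂ fun s hs => le_principal_iff.2 ?_
    obtain ⟨hFs, r, U, hU, rfl⟩ := hs
    exact exists_admissible_of_isOpen hU hFs
  exact hl hV

end JetCondition

end Conditions

/-! ### Limits of rapidly converging sequences -/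

section Limits

variable {X : MfdCorners.{u}} {Y : MfdCorners.{v}}

/-- Order zero is controlled by the target point, as the zeroth Taylor coefficient always vanishes;
positive orders are controlled by the coefficients. -/
lemma dist_iteratedFDerivWithin_localRep_le {m k : ℕ} (hk : k ≤ m) (φ : Chart X) (ψ : Chart Y)
    (F G : X → Y) {p : X} (hp : p ∈ φ.1.source) (i : Fin Y.dim) :
    dist (iteratedFDerivWithin ℝ k (localRep φ ψ F i) (range X.I) (φ.1.extend X.I p))
      (iteratedFDerivWithin ℝ k (localRep φ ψ G i) (range X.I) (φ.1.extend X.I p)) ≤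
    dist (jetVec Y (mapCoord m φ ψ F p)) (jetVec Y (mapCoord m φ ψ G p)) := by
  rcases Nat.eq_zero_or_pos k with rfl | hk0
  · simp only [iteratedFDerivWithin_zero_eq_comp, Function.comp_apply, LinearIsometryEquiv.dist_map,
      localRep, φ.1.extend_left_inv hp]
    refine le_trans ?_ (le_max_left _ _)
    rw [dist_eq_norm, dist_eq_norm]
    exact PiLp.norm_apply_le (ψ.1.extend Y.I (F p) - ψ.1.extend Y.I (G p)) i
  · have hF := mapCoord_of_ne_zero φ ψ F p i (⟨k, by omega⟩ : Fin (m + 1)) hk0.ne'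
    have hG := mapCoord_of_ne_zero φ ψ G p i (⟨k, by omega⟩ : Fin (m + 1)) hk0.ne'
    rw [← hF, ← hG]
    exact ((dist_le_pi_dist _ _ _).trans (dist_le_pi_dist _ _ i)).trans (le_max_right _ _)

namespace JetCondition

/-- From the index `N` on, the sequence `F` satisfies the condition `c`, and the jets of successive
members in the charts of `c` are close. -/
def FastOn (c : JetCondition X Y) (F : ℕ → SmoothMap X Y) (N : ℕ) : Prop :=
  ∀ m ≥ N, ∀ p ∈ c.K, c.Holds (F m) p ∧
    dist (jetVec Y (mapCoord m c.φ c.ψ (F m) p)) (jetVec Y (mapCoord m c.φ c.ψ (F (m + 1)) p)) <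
      (1 / 2) ^ m

variable {c : JetCondition X Y} {F : ℕ → SmoothMap X Y} {N : ℕ}

lemma FastOn.exists_tendsto (h : c.FastOn F N) {p : X} (hp : p ∈ c.K) :
    ∃ q ∈ c.ψ.1.source, Tendsto (fun n => F n p) atTop (𝓝 q) := by
  obtain ⟨L, hL, hLt, hCL⟩ := c.exists_isCompact
  have h1 : UniformCauchySeqOn (fun n p => Y.I (c.ψ.1 (F n p))) atTop c.K :=
    uniformCauchySeqOn_of_le_geometric N fun m hm x hx =>
      (le_max_left _ _).trans (h m hm x hx).2.le
  obtain ⟨e, he⟩ := cauchySeq_tendsto_of_complete (h1.cauchySeq hp)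
  -- The compact set `L` inside the chart target prevents the limit from leaving the chart.
  obtain ⟨y, hy, rfl⟩ : e ∈ Y.I '' L :=
    (hL.image Y.I.continuous).isClosed.mem_of_tendsto he
      (eventually_atTop.2 ⟨N, fun m hm => ⟨_, hCL _ (h m hm p hp).1.2, rfl⟩⟩)
  refine ⟨c.ψ.1.symm y, c.ψ.1.map_target (hLt hy), ?_⟩
  have h2 : Tendsto (fun n => c.ψ.1 (F n p)) atTop (𝓝 y) :=
    Y.I.isClosedEmbedding.isInducing.tendsto_nhds_iff.2 he
  refine ((c.ψ.1.continuousAt_symm (hLt hy)).tendsto.comp h2).congr' ?_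
  filter_upwards [eventually_ge_atTop N] with m hm
  exact c.ψ.1.left_inv (h m hm p hp).1.1

/-- In the chart, a small ball around `p` meets the quadrant in a convex set, so termwise
differentiation applies even at corners. The jets at `p` converge, and closedness of `C` passes the
condition to `G`. -/
lemma FastOn.limit (h : c.FastOn F N) {G : X → Y}
    (hG : ∀ p, Tendsto (fun n => F n p) atTop (𝓝 (G p))) {p : X} (hp : p ∈ interior c.K) :
    ContMDiffAt X.I Y.I ∞ G p ∧ c.Holds G p := by
  have hsrc : ∀ q ∈ c.K, G q ∈ c.ψ.1.source := by
    intro q hq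
    obtain ⟨y, hy, hlim⟩ := h.exists_tendsto hq
    rwa [tendsto_nhds_unique (hG q) hlim]
  have hpK := interior_subset hp
  have hpφ := c.subset_source hpK
  obtain ⟨o, ho, hpo, hos⟩ := exists_isOpen_chart c.φ (isOpen_interior (s := c.K))
  obtain ⟨δ, hδ, hball⟩ := Metric.isOpen_iff.1 ho _ (hpo p ⟨hpφ, hp⟩)
  set x₀ := c.φ.1.extend X.I p with hx₀
  set b := Metric.ball x₀ δ with hb
  have hbo : IsOpen b := Metric.isOpen_ball
  set s := range X.I ∩ b with hs
  have hconv : Convex ℝ s := X.I.convex_range.inter (convex_ball _ _)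
  have huniq : UniqueDiffOn ℝ s := X.I.uniqueDiffOn.inter hbo
  have hx₀b : x₀ ∈ b := Metric.mem_ball_self hδ
  have hx₀s : x₀ ∈ s := ⟨mem_range_self _, hx₀b⟩
  have hsK : ∀ x ∈ s, x ∈ (c.φ.1.extend X.I).target ∧ (c.φ.1.extend X.I).symm x ∈ c.K :=
    fun x hx => ⟨(hos x ⟨hx.1, hball hx.2⟩).1, interior_subset (hos x ⟨hx.1, hball hx.2⟩).2⟩
  have hψ : ∀ q ∈ c.K, Tendsto (fun n => c.ψ.1.extend Y.I (F n q)) atTop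
      (𝓝 (c.ψ.1.extend Y.I (G q))) := fun q hq =>
    (c.ψ.1.continuousAt_extend (I := Y.I) (hsrc q hq)).tendsto.comp (hG q)
  have key : ∀ i, ContDiffOn ℝ ∞ (localRep c.φ c.ψ G i) s ∧ ∀ k : ℕ, ∀ x ∈ s,
      Tendsto (fun n => iteratedFDerivWithin ℝ k (localRep c.φ c.ψ (F n) i) s x) atTop
        (𝓝 (iteratedFDerivWithin ℝ k (localRep c.φ c.ψ G i) s x)) := by
    intro i
    refine contDiffOn_and_tendsto_of_uniformCauchySeqOn hconv huniq ?_ ?_ ?_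
    · filter_upwards [eventually_ge_atTop N] with n hn
      exact contDiffOn_localRep c.φ c.ψ (F n) i
        fun x hx => ⟨(hsK x hx).1, (h n hn _ (hsK x hx).2).1.1⟩
    -- The distance at stage `m` involves `m`-jets, so derivatives of order `k` are controlled only
    -- from `m = k` on.
    · refine fun k => uniformCauchySeqOn_of_le_geometric (max N k) fun m hm x hx => ?_
      obtain ⟨hxt, hxK⟩ := hsK x hx
      have h1 := dist_iteratedFDerivWithin_localRep_le ((le_max_right N k).trans hm) c.φ c.ψ
        (F m) (F (m + 1)) (c.subset_source hxK) i
      rw [(c.φ.1.extend X.I).right_inv hxt] at h1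
      simp only [hs, iteratedFDerivWithin_inter_open hbo hx.2]
      exact h1.trans (h m ((le_max_left N k).trans hm) _ hxK).2.le
    · intro x hx
      exact ((EuclideanSpace.proj i : Y.E →L[ℝ] ℝ).continuous.tendsto _).comp
        (hψ _ (hsK x hx).2)
  have hsmooth : ContDiffWithinAt ℝ ∞ (c.ψ.1.extend Y.I ∘ G ∘ (c.φ.1.extend X.I).symm)
      (range X.I) x₀ := contDiffWithinAt_euclidean.2 fun i =>
    ((key i).1 x₀ hx₀s).mono_of_mem_nhdsWithin (inter_mem_nhdsWithin _ (hbo.mem_nhds hx₀b))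
  have hcont : ContinuousAt G p := by
    have h1 : Tendsto (c.φ.1.extend X.I) (𝓝 p) (𝓝[range X.I] x₀) :=
      tendsto_nhdsWithin_iff.2 ⟨c.φ.1.continuousAt_extend hpφ,
        Eventually.of_forall fun _ => mem_range_self _⟩
    have h2 := hsmooth.continuousWithinAt.tendsto.comp h1
    have h3 := c.ψ.1.continuousAt_extend_symm (I := Y.I) (hsrc p hpK)
    rw [ContinuousAt, c.ψ.1.extend_left_inv (hsrc p hpK)] at h3
    simp only [Function.comp_apply, hx₀, c.φ.1.extend_left_inv hpφ] at h2
    refine (h3.comp h2).congr' ?_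
    filter_upwards [isOpen_interior.mem_nhds hp] with q hq
    have hqK := interior_subset hq
    simp only [Function.comp_apply, c.φ.1.extend_left_inv (c.subset_source hqK),
      c.ψ.1.extend_left_inv (hsrc q hqK)]
  refine ⟨(contMDiffAt_iff_of_mem_maximalAtlas c.φ.2 c.ψ.2 hpφ (hsrc p hpK)).2
    ⟨hcont, hsmooth⟩, hsrc p hpK, ?_⟩
  have hlim : Tendsto (fun n => mapCoord c.r c.φ c.ψ (F n) p) atTop
      (𝓝 (mapCoord c.r c.φ c.ψ G p)) := by
    refine tendsto_const_nhds.prodMk_nhds (Tendsto.prodMk_nhds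
      ((c.ψ.1.continuousAt (hsrc p hpK)).tendsto.comp (hG p)) ?_)
    refine tendsto_pi_nhds.2 fun i => tendsto_pi_nhds.2 fun k => ?_
    change Tendsto (fun n => (mapCoord c.r c.φ c.ψ (F n) p).2.2 i k) atTop
      (𝓝 ((mapCoord c.r c.φ c.ψ G p).2.2 i k))
    by_cases hk : (k : ℕ) = 0
    · simp only [mapCoord_zero _ hpφ i k hk]
      exact tendsto_const_nhds
    · simp only [mapCoord_of_ne_zero c.φ c.ψ _ p i k hk]
      have := (key i).2 k x₀ hx₀s
      simpa only [hs, iteratedFDerivWithin_inter_open hbo hx₀b] using this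
  exact c.isClosed_C.mem_of_tendsto hlim
    (eventually_atTop.2 ⟨N, fun m hm => (h m hm p hpK).1.2⟩)

/-- A sequence of smooth maps which satisfies more and more conditions and is Cauchy in their
charts converges to a smooth map that satisfies all conditions. -/
lemma exists_limit {A : ℕ → Set (JetCondition X Y)} (hA : Admissible (A 0)) (hmono : Monotone A)
    {F : ℕ → SmoothMap X Y} (hF : ∀ n, F n ∈ strictSet (A n))
    (hclose : ∀ n, F (n + 1) ∈ closeSet (A n) (F n) n ((1 / 2) ^ n)) :
    ∃ G : SmoothMap X Y, (∀ p, Tendsto (fun n => F n p) atTop (𝓝 (G p))) ∧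
      ∀ n, G ∈ weakSet (A n) := by
  have hfast : ∀ n, ∀ c ∈ A n, c.FastOn F n := fun n c hc m hm p hp =>
    ⟨(hF m c (hmono hm hc) p hp).holds, (hclose m c (hmono hm hc) p hp).2⟩
  have hex : ∀ p, ∃ q, Tendsto (fun n => F n p) atTop (𝓝 q) := by
    intro p
    obtain ⟨c, hc, hp⟩ := hA.cover p
    obtain ⟨q, -, hq⟩ := (hfast 0 c hc).exists_tendsto (interior_subset hp)
    exact ⟨q, hq⟩
  choose G hG using hex
  refine ⟨⟨G, fun p => ?_⟩, hG, fun n c hc p hp => ((hfast n c hc).limit hG hp).2⟩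
  obtain ⟨c, hc, hp⟩ := hA.cover p
  exact ((hfast 0 c hc).limit hG hp).1

end JetCondition

/-! ### The Baire category argument -/

open JetCondition in
/-- A set of smooth maps that is closed under pointwise convergence is a Baire space in the Whitney
topology. -/
lemma baireSpace_subtype_of_pointwise_closed {P : SmoothMap X Y → Prop}
    (hP : ∀ (F : ℕ → SmoothMap X Y) (G : SmoothMap X Y), (∀ n, P (F n)) →
      (∀ p, Tendsto (fun n => F n p) atTop (𝓝 (G p))) → P G) :
    BaireSpace {F : SmoothMap X Y // P F} := by
  refine ⟨fun f hfo hfd => dense_iff_inter_open.2 fun V hV ⟨F₀, hF₀⟩ => ?_⟩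
  have hopen : ∀ W : Set {F : SmoothMap X Y // P F}, IsOpen W → ∀ F ∈ W,
      ∃ A, Admissible A ∧ F.1 ∈ strictSet A ∧ ∀ G : {F : SmoothMap X Y // P F},
        G.1 ∈ weakSet A → G ∈ W := by
    intro W hW F hF
    obtain ⟨W', hW', rfl⟩ := isOpen_induced_iff.1 hW
    obtain ⟨A, hA, hFA, hAW⟩ := exists_admissible (hW'.mem_nhds hF)
    exact ⟨A, hA, hFA, fun G hG => hAW hG⟩
  let T := {s : Set (JetCondition X Y) × {F : SmoothMap X Y // P F} //
    Admissible s.1 ∧ s.2.1 ∈ strictSet s.1}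
  have hstep : ∀ (n : ℕ) (s : T), ∃ s' : T, s.1.1 ⊆ s'.1.1 ∧
      s'.1.2.1 ∈ closeSet s.1.1 s.1.2.1 n ((1 / 2) ^ n) ∧
      ∀ G : {F : SmoothMap X Y // P F}, G.1 ∈ weakSet s'.1.1 → G ∈ f n := by
    rintro n ⟨⟨A, F⟩, hA, hF⟩
    -- The open set in which density of `f n` is used is nonempty, since it contains `F` itself.
    obtain ⟨F', ⟨hF'A, hF'c⟩, hF'⟩ := (hfd n).inter_open_nonempty
      (Subtype.val ⁻¹' (strictSet A ∩ closeSet A F.1 n ((1 / 2) ^ n)))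
      (((isOpen_strictSet hA).inter (isOpen_closeSet hA hF n _)).preimage continuous_subtype_val)
      ⟨F, hF, self_mem_closeSet hF n (by positivity)⟩
    obtain ⟨B, hB, hF'B, hBf⟩ := hopen (f n) (hfo n) F' hF'
    exact ⟨⟨(A ∪ B, F'), hA.union hB, fun c hc => hc.elim (hF'A c) (hF'B c)⟩,
      subset_union_left, hF'c, fun G hG => hBf G (weakSet_anti subset_union_right hG)⟩
  choose step hsub hclose hmem using hstep
  obtain ⟨A₀, hA₀, hFA₀, hA₀V⟩ := hopen V hV F₀ hF₀
  let s : ℕ → T := fun n => Nat.rec ⟨(A₀, F₀), hA₀, hFA₀⟩ step n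
  obtain ⟨G, hG, hGA⟩ := exists_limit (A := fun n => (s n).1.1) (F := fun n => (s n).1.2.1) hA₀
    (monotone_nat_of_le_succ fun n => hsub n (s n)) (fun n => (s n).2.2)
    fun n => hclose n (s n)
  have hPG : P G := hP _ G (fun n => (s n).1.2.2) hG
  -- Stage `n` installs the conditions forcing `f n` in the family with index `n + 1`.
  exact ⟨⟨G, hPG⟩, hA₀V _ (hGA 0), mem_iInter.2 fun n => hmem n (s n) _ (hGA (n + 1))⟩

end Limits

end

theorem mainTheorem8 {S : Type w} [PartialOrder S] [OrderTop S] [Finite S]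
    (X : PreArrangement.{u} S) (Y : PreArrangement.{v} S) (hX : X.IsClosed) (hY : Y.IsClosed) :
    BaireSpace (RelMap X Y) :=
  baireSpace_subtype_of_pointwise_closed fun _ _ hF hG s p hp =>
    (hY s ⊤ le_top).isClosed_range.mem_of_tendsto (hG p) (Eventually.of_forall fun n => hF n s hp)
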